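/- A euclidean Jordan algebra is a finite-dimensional real vector space $J$ with a commutative bilinear (not necessarily associative) product such that $a\cdot(b\cdot a^2)=(a\cdot b)\cdot a^2$ for all $a,b\in J$, and such that $a^2+b^2=0$ implies $a=b=0$. It is called simple if $J\neq 0$ and its only ideals (linear subspaces $I$ with $J\cdot I\subseteq I$) are $0$ and $J$. The center of an algebra $A$ with commutative product is the set of $x\in A$ with $x(ab)=(xa)b$ for all $a,b\in A$, and a central symmetry of $A$ is an element $s$ of the center such that $s^2$ is the multiplicative unit of $A$. (1) Every simple euclidean Jordan algebra $J$ has a multiplicative unit $e$, and its center is $\mathbb R e=\{\lambda e:\lambda\in\mathbb R\}$. (2) Let $J=J_1\times\cdots\times J_n$ be a product of simple euclidean Jordan algebras, with componentwise operations, and let $e_i$ be the unit of $J_i$, regarded as an element of $J$. Then the central symmetries of $J$ are exactly the elements $\sum_{i=1}^n\epsilon_i e_i$ with $\epsilon_i\in\{1,-1\}$. -/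

import Mathlib

/-- A euclidean Jordan algebra: a finite-dimensional real vector space with a bilinear commutative
product satisfying the Jordan identity `(a * b) * a² = a * (b * a²)` (this is `IsCommJordan`), and
such that `a² + b² = 0` only if `a = b = 0`. No unit element is part of the definition. -/
class IsEuclideanJordanAlgebra (J : Type*) [NonUnitalNonAssocCommRing J] [Module ℝ J]
    [IsScalarTower ℝ J J] [SMulCommClass ℝ J J] : Prop
    extends IsCommJordan J, Module.Finite ℝ J where
  formally_real : ∀ a b : J, a * a + b * b = 0 → a = 0 ∧ b = 0

/-- A (commutative, real) algebra is simple if it is nonzero and its only ideals are `0` and the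
whole algebra. Ideals of an algebra are linear subspaces. -/
class IsSimpleRealAlgebra (J : Type*) [NonUnitalNonAssocCommRing J] [Module ℝ J] : Prop
    extends Nontrivial J where
  eq_bot_or_eq_top : ∀ I : Submodule ℝ J, (∀ a : J, ∀ x ∈ I, a * x ∈ I) → I = ⊥ ∨ I = ⊤

/-- `e` is the multiplicative unit element of `A`. -/
def IsUnitElement {A : Type*} [Mul A] (e : A) : Prop :=
  ∀ x : A, e * x = x ∧ x * e = x

/-- A central symmetry: an element of the center whose square is the unit element. -/
def IsCentralSymmetry {A : Type*} [Mul A] (s : A) : Prop :=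
  s ∈ Set.center A ∧ IsUnitElement (s * s)

/-- In a commutative algebra, membership in Mathlib's center is the single identity
`x(ab) = (xa)b`. -/
theorem mem_center_iff_assoc {J : Type*} [NonUnitalNonAssocCommRing J] (x : J) :
    x ∈ Set.center J ↔ ∀ a b : J, x * (a * b) = (x * a) * b := by
  refine ⟨fun h => h.left_assoc, fun h => ⟨fun a => mul_comm x a, h, fun a b => ?_⟩⟩
  rw [mul_comm (a * b) x, mul_comm a b, h b a, mul_comm x b, mul_comm]

/-! Write `L a` for multiplication by `a`. The form `(a, b) ↦ tr L (a * b)` is associative, so its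
radical is an ideal. Formal reality yields a nonzero idempotent, whose trace is positive, so
simplicity makes the form nondegenerate (`eq_zero_of_mulTrace_mul`); the vector representing the
trace is the unit. For central `z`, kernels of polynomials in `L z` are ideals, so a real
irreducible factor of the minimal polynomial already kills `L z`. A linear factor makes `z` a
scalar; a quadratic one contradicts formal reality. Central symmetries then reduce, componentwise,
to `r ^ 2 = 1`. -/

open LinearMap Polynomial

section Jordan

variable {J : Type*} [NonUnitalNonAssocCommRing J]

theorem IsUnitElement.ne_zero [Nontrivial J] {e : J} (he : IsUnitElement e) : e ≠ 0 := by
  rintro rfl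
  obtain ⟨x, hx⟩ := exists_ne (0 : J)
  exact hx (by rw [← (he x).1, zero_mul])

variable [Module ℝ J]

/-! ### Linearized Jordan identity and powers -/

/-- The full linearization of the Jordan identity. -/
theorem jordan_linearized [IsCommJordan J] (a b d c : J) :
    ((a * b) * d) * c = (a * d) * (b * c) + (b * d) * (a * c) + (a * b) * (d * c)
      - a * (d * (b * c)) - b * (d * (a * c)) := by
  have h := two_nsmul_lie_lmul_lmul_add_add_eq_zero a b c
  have h2 := DFunLike.congr_fun h d
  have h3 : (2 : ℝ) • ((a * ((b * c) * d) - (b * c) * (a * d)) + (b * ((c * a) * d)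
      - (c * a) * (b * d)) + (c * ((a * b) * d) - (a * b) * (c * d))) = 0 := by
    rw [ofNat_smul_eq_nsmul ℝ]
    exact h2
  have h4 := (smul_eq_zero.mp h3).resolve_left two_ne_zero
  rw [mul_comm ((a * b) * d) c, mul_comm (a * d), mul_comm (b * d), mul_comm d c,
    mul_comm d (b * c), mul_comm d (a * c), mul_comm a c]
  rw [← sub_eq_zero, ← h4]
  abel

theorem IsUnitElement.smul_mem_center [IsScalarTower ℝ J J] {e : J} (he : IsUnitElement e) (r : ℝ) :
    r • e ∈ Set.center J :=
  (mem_center_iff_assoc _).mpr fun a b => by simp only [smul_mul_assoc, (he _).1]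

variable [SMulCommClass ℝ J J]

theorem mulLeft_mul_mul [IsCommJordan J] (a b d : J) :
    mulLeft ℝ ((a * b) * d) = mulLeft ℝ (a * d) * mulLeft ℝ b + mulLeft ℝ (b * d) * mulLeft ℝ a
      + mulLeft ℝ (a * b) * mulLeft ℝ d - mulLeft ℝ a * mulLeft ℝ d * mulLeft ℝ b
      - mulLeft ℝ b * mulLeft ℝ d * mulLeft ℝ a := by
  ext c
  simpa using jordan_linearized a b d c

/-- The operators of multiplication by the powers `(L x) ^ n x` commute with every operator
commuting with `L x` and `L (x * x)`. -/
theorem commute_mulLeft_pow [IsCommJordan J] (x : J) (T : Module.End ℝ J)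
    (h1 : Commute T (mulLeft ℝ x)) (h2 : Commute T (mulLeft ℝ (x * x))) (n : ℕ) :
    Commute T (mulLeft ℝ ((mulLeft ℝ x ^ n) x)) ∧
      Commute T (mulLeft ℝ ((mulLeft ℝ x ^ (n + 1)) x)) := by
  induction n with
  | zero => simpa using ⟨h1, h2⟩
  | succ n ih =>
    refine ⟨ih.2, ?_⟩
    -- This bracketing lets `mulLeft_mul_mul` express the new operator through those of `x`, `x * x`
    -- and the two preceding powers.
    have e : (mulLeft ℝ x ^ (n + 1 + 1)) x = (x * (mulLeft ℝ x ^ n) x) * x := by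
      simp [pow_succ', mul_comm]
    have e' : (mulLeft ℝ x ^ (n + 1)) x = x * (mulLeft ℝ x ^ n) x := by simp [pow_succ']
    rw [e, mulLeft_mul_mul]
    rw [e'] at ih
    have h3 := ih.2
    have h4 := ih.2
    rw [mul_comm] at h4
    exact ((((h2.mul_right ih.1).add_right (h4.mul_right h1)).add_right
      (h3.mul_right h1)).sub_right ((h1.mul_right h1).mul_right ih.1)).sub_right
      ((ih.1.mul_right h1).mul_right h1)

theorem commute_mulLeft_mulLeft_pow [IsCommJordan J] (x : J) (n : ℕ) :
    Commute (mulLeft ℝ x) (mulLeft ℝ ((mulLeft ℝ x ^ n) x)) := by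
  refine (commute_mulLeft_pow x _ (Commute.refl _) ?_ n).1
  ext b
  have h := IsCommJordan.lmul_comm_rmul_rmul x b
  rw [mul_comm (x * b), mul_comm b] at h
  exact h.symm

/-- `(L x ^ n) x` plays the role of the power `n + 1` of `x`, hence the extra `1`. -/
theorem pow_apply_mul_pow_apply [IsCommJordan J] (x : J) (m n : ℕ) :
    (mulLeft ℝ x ^ m) x * (mulLeft ℝ x ^ n) x = (mulLeft ℝ x ^ (m + n + 1)) x := by
  have h := ((commute_mulLeft_mulLeft_pow x n).pow_left m).eq
  have h' := DFunLike.congr_fun h x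
  simp only [Module.End.mul_apply, mulLeft_apply] at h'
  rw [mul_comm, ← h', mul_comm _ x, show x * (mulLeft ℝ x ^ n) x = (mulLeft ℝ x ^ (n + 1)) x by
    simp [pow_succ'], ← Module.End.mul_apply, ← pow_add, add_assoc]

/-- In a simple algebra, a polynomial in multiplication by a central element vanishes as soon as it
is a nontrivial divisor of the minimal polynomial. -/
theorem aeval_mulLeft_eq_zero_of_dvd_minpoly [Module.Finite ℝ J] [IsSimpleRealAlgebra J] {z : J}
    (hz : z ∈ Set.center J) {f : ℝ[X]} (hf : ¬ IsUnit f)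
    (hdvd : f ∣ minpoly ℝ (mulLeft ℝ z)) : aeval (mulLeft ℝ z) f = 0 := by
  set L := mulLeft ℝ z with hL
  have hcomm : ∀ (a : J) (f : ℝ[X]), Commute (aeval L f) (mulLeft ℝ a) := fun a f => by
    have h : Commute L (mulLeft ℝ a) := by
      ext b
      have h1 := (mem_center_iff_assoc z).mp hz
      change z * (a * b) = a * (z * b)
      rw [mul_comm a b, h1 b a, mul_comm a]
    induction f using Polynomial.induction_on' with
    | add p q hp hq => rw [map_add]; exact hp.add_left hq
    | monomial n r =>
      rw [aeval_monomial]
      exact Commute.mul_left (Algebra.commutes r _) (h.pow_left n)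
  have hideal : ∀ a : J, ∀ x ∈ LinearMap.ker (aeval L f), a * x ∈ LinearMap.ker (aeval L f) := by
    intro a x hx
    have h := DFunLike.congr_fun (hcomm a f).eq x
    simp only [Module.End.mul_apply, mulLeft_apply, LinearMap.mem_ker.mp hx, mul_zero] at h
    exact h
  rcases IsSimpleRealAlgebra.eq_bot_or_eq_top _ hideal with h | h
  -- If `f (L)` is injective, the cofactor of `f` annihilates `L`, so minimality makes `f` a unit.
  · exfalso
    obtain ⟨q, hq⟩ := hdvd
    have hq0 : aeval L q = 0 := by
      ext x
      refine LinearMap.ker_eq_bot.mp h ?_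
      rw [LinearMap.zero_apply, map_zero, ← Module.End.mul_apply, ← map_mul, ← hq, minpoly.aeval,
        LinearMap.zero_apply]
    have hne : f * q ≠ 0 := hq ▸ minpoly.ne_zero (Algebra.IsIntegral.isIntegral L)
    obtain ⟨r, hr⟩ := minpoly.dvd ℝ L hq0
    rw [hq] at hr
    refine hf (IsUnit.of_mul_eq_one r (mul_left_cancel₀ (right_ne_zero_of_mul hne) ?_))
    linear_combination -hr
  · exact LinearMap.ker_eq_top.mp h

variable [IsScalarTower ℝ J J]

/-! ### The trace form -/

/-- The trace of left multiplication, as a linear functional. -/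
noncomputable def mulTrace (J : Type*) [NonUnitalNonAssocCommRing J] [Module ℝ J]
    [IsScalarTower ℝ J J] [SMulCommClass ℝ J J] : J →ₗ[ℝ] ℝ :=
  LinearMap.trace ℝ J ∘ₗ LinearMap.mul ℝ J

theorem mulTrace_apply (a : J) : mulTrace J a = LinearMap.trace ℝ J (mulLeft ℝ a) := rfl

/-- In the expansions by `mulLeft_mul_mul` the quadratic terms agree and the cubic ones differ by
cyclic permutations, invisible to the trace. -/
theorem mulTrace_assoc [IsCommJordan J] (a b d : J) :
    mulTrace J ((a * b) * d) = mulTrace J (a * (b * d)) := by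
  rw [mul_comm a (b * d), mul_comm b d, mulTrace_apply, mulTrace_apply, mulLeft_mul_mul a b d,
    mulLeft_mul_mul d b a]
  have h1 := LinearMap.trace_mul_comm ℝ (mulLeft ℝ a * mulLeft ℝ d) (mulLeft ℝ b)
  have h2 := LinearMap.trace_mul_comm ℝ (mulLeft ℝ d * mulLeft ℝ a) (mulLeft ℝ b)
  simp only [map_sub, map_add, ← mul_assoc] at *
  rw [h1, h2, mul_comm d a, mul_comm b a, mul_comm b d]
  ring

/-- Left multiplication by a nonzero idempotent has positive trace. -/
theorem mulTrace_pos_of_idempotent [IsCommJordan J] [Module.Finite ℝ J] {c : J} (hc : c * c = c)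
    (hc0 : c ≠ 0) : 0 < mulTrace J c := by
  have hL := mulLeft_mul_mul c c c
  simp only [hc] at hL
  set L := mulLeft ℝ c with hLdef
  -- The eigenvalues of `L` lie in `{0, 1/2, 1}`; the projections onto the eigenspaces for `1` and
  -- `1/2` are `2L² - L` and `4L - 4L²`.
  have hcube : (2 : ℝ) • (L * L * L) = (3 : ℝ) • (L * L) - L := by
    rw [eq_sub_iff_add_eq]
    nth_rewrite 4 [hL]
    module
  have hcube' : L * L * L = (3 / 2 : ℝ) • (L * L) - (1 / 2 : ℝ) • L := by
    have := congrArg (fun T => (1 / 2 : ℝ) • T) hcube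
    simp only [smul_smul, smul_sub] at this
    norm_num at this ⊢
    exact this
  have htr : ∀ P : Module.End ℝ J, P * P = P → LinearMap.trace ℝ J P
      = (Module.finrank ℝ (LinearMap.range P) : ℝ) := fun P hP =>
    LinearMap.IsProj.trace (p := LinearMap.range P)
      (LinearMap.IsIdempotentElem.isProj_range P hP)
  have h1 := htr ((2 : ℝ) • (L * L) - L) (by
    simp only [sub_mul, mul_sub, smul_mul_assoc, mul_smul_comm, ← mul_assoc, hcube']
    module)
  have h2 := htr ((4 : ℝ) • L - (4 : ℝ) • (L * L)) (by
    simp only [sub_mul, mul_sub, smul_mul_assoc, mul_smul_comm, ← mul_assoc, hcube']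
    module)
  have hpos : 0 < Module.finrank ℝ (LinearMap.range ((2 : ℝ) • (L * L) - L)) := by
    rw [Module.finrank_pos_iff_exists_ne_zero]
    refine ⟨⟨c, c, ?_⟩, fun h => hc0 (congrArg Subtype.val h)⟩
    simp [hLdef, hc, two_smul]
  have hsum : L = ((2 : ℝ) • (L * L) - L) + (1 / 2 : ℝ) • ((4 : ℝ) • L - (4 : ℝ) • (L * L)) := by
    module
  rw [mulTrace_apply, ← hLdef, hsum, map_add, map_smul, h1, h2, smul_eq_mul]
  positivity

/-- Power associativity, in polynomial form. -/
theorem aeval_apply_mul_aeval_apply [IsCommJordan J] (x : J) (p q : ℝ[X]) :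
    aeval (mulLeft ℝ x) p x * aeval (mulLeft ℝ x) q x = aeval (mulLeft ℝ x) (X * p * q) x := by
  induction p using Polynomial.induction_on' with
  | add p₁ p₂ h₁ h₂ => simp only [map_add, LinearMap.add_apply, add_mul, mul_add, h₁, h₂]
  | monomial m r =>
    induction q using Polynomial.induction_on' with
    | add p₁ p₂ h₁ h₂ => simp only [map_add, LinearMap.add_apply, mul_add, h₁, h₂]
    | monomial n s =>
      rw [X_mul_monomial, monomial_mul_monomial]
      simp only [aeval_monomial, ← Algebra.smul_def, LinearMap.smul_apply, smul_mul_smul_comm,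
        pow_apply_mul_pow_apply]
      rw [show m + 1 + n = m + n + 1 by ring]

/-! ### Idempotents, unit and center -/

theorem mul_self_eq_zero_of_euclidean [IsEuclideanJordanAlgebra J] {a : J} (h : a * a = 0) :
    a = 0 :=
  (IsEuclideanJordanAlgebra.formally_real a 0 (by simpa using h)).1

/-- Without nilpotents, factors `X` can be stripped from a polynomial annihilating `x`. The nonzero
constant term left over makes `X` invertible modulo it, giving an identity among the polynomials in
`x`. -/
theorem exists_idempotent_ne_zero [IsEuclideanJordanAlgebra J] [Nontrivial J] :
    ∃ c : J, c * c = c ∧ c ≠ 0 := by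
  obtain ⟨x, hx⟩ := exists_ne (0 : J)
  set L := mulLeft ℝ x with hL
  have hstrip : ∀ q : ℝ[X], aeval L (X * q) x = 0 → aeval L q x = 0 := fun q hq => by
    apply mul_self_eq_zero_of_euclidean
    rw [aeval_apply_mul_aeval_apply, mul_comm, map_mul, Module.End.mul_apply, hq, map_zero]
  have hpow : ∀ (k : ℕ) (q : ℝ[X]), aeval L (X ^ k * q) x = 0 → aeval L q x = 0 := by
    intro k
    induction k with
    | zero => simp
    | succ k ih => exact fun q hq => ih q (hstrip _ (by rwa [← mul_assoc, ← pow_succ']))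
  obtain ⟨g, hg, hg0⟩ : ∃ g : ℝ[X], aeval L g x = 0 ∧ g.coeff 0 ≠ 0 := by
    obtain ⟨g, hg, hdvd⟩ := exists_eq_pow_rootMultiplicity_mul_and_not_dvd (minpoly ℝ L)
      (minpoly.ne_zero (Algebra.IsIntegral.isIntegral L)) 0
    rw [C_0, sub_zero] at hg hdvd
    refine ⟨g, hpow (rootMultiplicity 0 (minpoly ℝ L)) g ?_, fun h => hdvd (X_dvd_iff.mpr h)⟩
    exact (congrArg (fun f => aeval L f x) hg).symm.trans (by simp [minpoly.aeval])
  obtain ⟨h, hh⟩ : ∃ h : ℝ[X], aeval L (X * h - 1) x = 0 := by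
    refine ⟨-C (g.coeff 0)⁻¹ * g.divX, ?_⟩
    have e : X * (-C (g.coeff 0)⁻¹ * g.divX) - 1 = -C (g.coeff 0)⁻¹ * g := by
      have : C (g.coeff 0)⁻¹ * C (g.coeff 0) = 1 := by rw [← C_mul, inv_mul_cancel₀ hg0, C_1]
      linear_combination this - C (g.coeff 0)⁻¹ * divX_mul_X_add g
    rw [e, map_mul, Module.End.mul_apply, hg, map_zero]
  refine ⟨aeval L h x, ?_, fun h0 => hx ?_⟩
  · rw [aeval_apply_mul_aeval_apply, ← sub_eq_zero, ← LinearMap.sub_apply, ← map_sub,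
      show X * h * h - h = h * (X * h - 1) by ring, map_mul, Module.End.mul_apply, hh, map_zero]
  · simpa [h0] using hh

/-- The trace form of a simple euclidean Jordan algebra is nondegenerate. -/
theorem eq_zero_of_mulTrace_mul [IsEuclideanJordanAlgebra J] [IsSimpleRealAlgebra J] {a : J}
    (ha : ∀ b, mulTrace J (a * b) = 0) : a = 0 := by
  let B : J →ₗ[ℝ] J →ₗ[ℝ] ℝ := (LinearMap.mul ℝ J).compr₂ (mulTrace J)
  have hideal : ∀ b : J, ∀ x ∈ LinearMap.ker B, b * x ∈ LinearMap.ker B := fun b x hx => by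
    ext d
    have := DFunLike.congr_fun (show B x = 0 from hx) (b * d)
    simpa [B, mul_comm b x, mulTrace_assoc] using this
  rcases IsSimpleRealAlgebra.eq_bot_or_eq_top _ hideal with h | h
  · have ha' : a ∈ LinearMap.ker B := LinearMap.ext ha
    simpa [h] using ha'
  · obtain ⟨c, hc, hc0⟩ := exists_idempotent_ne_zero (J := J)
    have hmem : c ∈ LinearMap.ker B := h ▸ Submodule.mem_top
    have h0 : mulTrace J (c * c) = 0 := DFunLike.congr_fun (show B c = 0 from hmem) c
    rw [hc] at h0
    exact absurd h0 (mulTrace_pos_of_idempotent hc hc0).ne'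

/-- The unit element is the representative of the trace functional in the trace form. -/
theorem exists_isUnitElement [IsEuclideanJordanAlgebra J] [IsSimpleRealAlgebra J] :
    ∃ e : J, IsUnitElement e := by
  let B : J →ₗ[ℝ] Module.Dual ℝ J := (LinearMap.mul ℝ J).compr₂ (mulTrace J)
  have hinj : Function.Injective B := (injective_iff_map_eq_zero B).mpr fun a ha =>
    eq_zero_of_mulTrace_mul fun b => DFunLike.congr_fun ha b
  obtain ⟨e, he⟩ := (LinearMap.injective_iff_surjective_of_finrank_eq_finrank
    (Subspace.dual_finrank_eq (K := ℝ) (V := J)).symm).mp hinj (mulTrace J)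
  have h1 : ∀ x, e * x = x := fun x => by
    refine sub_eq_zero.mp (eq_zero_of_mulTrace_mul fun b => ?_)
    rw [sub_mul, map_sub, mulTrace_assoc, sub_eq_zero]
    exact DFunLike.congr_fun he (x * b)
  exact ⟨e, fun x => ⟨h1 x, by rw [mul_comm, h1]⟩⟩

theorem exists_eq_smul_of_mem_center [IsEuclideanJordanAlgebra J] [IsSimpleRealAlgebra J] {e z : J}
    (he : IsUnitElement e) (hz : z ∈ Set.center J) : ∃ r : ℝ, z = r • e := by
  have hint : IsIntegral ℝ (mulLeft ℝ z) := Algebra.IsIntegral.isIntegral _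
  obtain ⟨w, hw⟩ := IsAlgClosed.exists_aeval_eq_zero ℂ (minpoly ℝ (mulLeft ℝ z))
    (minpoly.degree_pos hint).ne'
  by_cases him : w.im = 0
  · have hroot : (minpoly ℝ (mulLeft ℝ z)).IsRoot w.re := by
      have : w = algebraMap ℝ ℂ w.re := Complex.ext rfl (by simpa using him)
      rw [this, aeval_algebraMap_apply] at hw
      simpa using hw
    have h := aeval_mulLeft_eq_zero_of_dvd_minpoly hz (not_isUnit_X_sub_C w.re)
      (dvd_iff_isRoot.mpr hroot)
    have h' := DFunLike.congr_fun h e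
    refine ⟨w.re, sub_eq_zero.mp ?_⟩
    simpa [Algebra.algebraMap_eq_smul_one, (he z).2] using h'
  · exfalso
    have hdvd := Polynomial.quadratic_dvd_of_aeval_eq_zero_im_ne_zero _ hw him
    have h := aeval_mulLeft_eq_zero_of_dvd_minpoly hz (fun hu => by
      have h2 : (X ^ 2 - C (2 * w.re) * X + C (‖w‖ ^ 2)).natDegree = 2 := by compute_degree!
      have h0 := natDegree_eq_zero_of_isUnit hu
      omega) hdvd
    have h' : z * z - (2 * w.re) • z + (‖w‖ ^ 2) • e = 0 := by
      have := DFunLike.congr_fun h e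
      simp only [map_add, map_sub, map_mul, aeval_X, aeval_C, LinearMap.add_apply,
        LinearMap.sub_apply, Algebra.algebraMap_eq_smul_one, smul_mul_assoc, one_mul, pow_two,
        Module.End.mul_apply, LinearMap.smul_apply, Module.End.one_apply, mulLeft_apply, (he z).2,
        LinearMap.zero_apply] at this
      rw [← this]
      module
    -- Completing the square, with `‖w‖ ^ 2 = w.re ^ 2 + w.im ^ 2`.
    have hsq : (z - w.re • e) * (z - w.re • e) + (w.im • e) * (w.im • e) = 0 := by
      rw [← h', Complex.sq_norm, Complex.normSq_apply]
      simp only [sub_mul, mul_sub, mul_smul_comm, smul_mul_assoc, (he _).1, (he _).2]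
      module
    have he0 : e = 0 :=
      (smul_eq_zero.mp (IsEuclideanJordanAlgebra.formally_real _ _ hsq).2).resolve_left him
    exact he.ne_zero he0

theorem isCentralSymmetry_iff [IsEuclideanJordanAlgebra J] [IsSimpleRealAlgebra J] {e : J}
    (he : IsUnitElement e) (s : J) :
    IsCentralSymmetry s ↔ ∃ r : ℝ, (r = 1 ∨ r = -1) ∧ s = r • e := by
  constructor
  · rintro ⟨hs, hu⟩
    obtain ⟨r, rfl⟩ := exists_eq_smul_of_mem_center he hs
    refine ⟨r, ?_, rfl⟩
    have h := (hu e).1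
    rw [(he _).2, smul_mul_smul_comm, (he e).1, ← sub_eq_zero] at h
    have h1 : (r * r - 1) • e = 0 := by rw [← h]; module
    exact mul_self_eq_one_iff.mp
      (sub_eq_zero.mp ((smul_eq_zero.mp h1).resolve_right he.ne_zero))
  · rintro ⟨r, hr, rfl⟩
    refine ⟨he.smul_mem_center r, ?_⟩
    rwa [smul_mul_smul_comm, (he e).1, mul_self_eq_one_iff.mpr hr, one_smul]

end Jordan

/-! ### Products -/

theorem isCentralSymmetry_pi_iff {ι : Type*} {J : ι → Type*}
    [∀ i, NonUnitalNonAssocCommRing (J i)] (s : ∀ i, J i) :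
    IsCentralSymmetry s ↔ ∀ i, IsCentralSymmetry (s i) := by
  classical
  unfold IsCentralSymmetry IsUnitElement
  rw [Set.center_pi, Set.mem_univ_pi]
  refine Iff.trans (and_congr_right fun _ => ?_) forall_and.symm
  constructor
  swap
  · exact fun h x => ⟨funext fun i => (h i _).1, funext fun i => (h i _).2⟩
  intro h i x
  have h' := h (Pi.single i x)
  exact ⟨by simpa using congrFun h'.1 i, by simpa using congrFun h'.2 i⟩

/-- (1) A simple euclidean Jordan algebra has a unit element `e`, and its center is `ℝ e`.
(2) In a finite product of simple euclidean Jordan algebras with units `e i`, the central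
symmetries are exactly the elements `∑ i, ± e i`. -/
theorem mainTheorem9 :
    (∀ (J : Type*) [NonUnitalNonAssocCommRing J] [Module ℝ J] [IsScalarTower ℝ J J]
        [SMulCommClass ℝ J J] [IsEuclideanJordanAlgebra J] [IsSimpleRealAlgebra J],
        ∃ e : J, IsUnitElement e ∧
          (NonUnitalSubalgebra.center ℝ J).toSubmodule = Submodule.span ℝ {e}) ∧
    (∀ (n : ℕ) (J : Fin n → Type*) [∀ i, NonUnitalNonAssocCommRing (J i)]
        [∀ i, Module ℝ (J i)] [∀ i, IsScalarTower ℝ (J i) (J i)]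
        [∀ i, SMulCommClass ℝ (J i) (J i)] [∀ i, IsEuclideanJordanAlgebra (J i)]
        [∀ i, IsSimpleRealAlgebra (J i)],
        ∃ e : ∀ i, J i, (∀ i, IsUnitElement (e i)) ∧
          ∀ s : (∀ i, J i), IsCentralSymmetry s ↔
            ∃ ε : Fin n → ℝ, (∀ i, ε i = 1 ∨ ε i = -1) ∧
              s = ∑ i, Pi.single i (ε i • e i)) := by
  refine ⟨fun J _ _ _ _ _ _ => ?_, fun n J _ _ _ _ _ _ => ?_⟩
  · obtain ⟨e, he⟩ := exists_isUnitElement (J := J)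
    refine ⟨e, he, le_antisymm (fun z hz => ?_) ?_⟩
    · obtain ⟨r, rfl⟩ := exists_eq_smul_of_mem_center he (z := z) hz
      exact Submodule.smul_mem _ _ (Submodule.mem_span_singleton_self e)
    · rw [Submodule.span_singleton_le_iff_mem]
      exact one_smul ℝ e ▸ he.smul_mem_center 1
  · choose e he using fun i => exists_isUnitElement (J := J i)
    refine ⟨e, he, fun s => ?_⟩
    simp only [isCentralSymmetry_pi_iff, fun i => isCentralSymmetry_iff (he i),
      Finset.univ_sum_single]
    constructor
    · intro h
      choose ε hε hs using h
      exact ⟨ε, hε, funext hs⟩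
    · rintro ⟨ε, hε, rfl⟩ i
      exact ⟨ε i, hε i, rfl⟩
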